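/- Let $d\ge 1$ and normalize the Fourier transform by $\hat f(\omega)=\mathcal F f(\omega)=\int_{\mathbb R^d} f(t)e^{-2\pi i t\cdot\omega}\,dt$, extended to $L^2(\mathbb R^d)$ by Plancherel and to $\mathcal S'(\mathbb R^d)$ by duality. Let $g_1,g_2\in L^2(\mathbb R^d)$. For $f,g\in L^2(\mathbb R^d)$ put $$V_gf(x,\omega)=\int_{\mathbb R^d} f(y)\,\overline{g(y-x)}\,e^{-2\pi i y\cdot\omega}\,dy,\qquad x,\omega\in\mathbb R^d,$$ and let $$\mathcal C_{g_1,g_2}(y)=\int_{\mathbb R^d} g_2(-u)\,\overline{g_1(y-u)}\,du,\qquad y\in\mathbb R^d,$$ be the window correlation function. For $m\in L^\infty(\mathbb R^d)$ let $T_mf=\mathcal F^{-1}(m\,\mathcal F f)$ be the Fourier multiplier, and let $A^{g_1,g_2}_{1\otimes m}$ be the STFT multiplier with symbol $(1\otimes m)(x,\omega)=m(\omega)$, defined weakly by $$\langle A^{g_1,g_2}_{1\otimes m}f,g\rangle=\iint_{\mathbb R^{2d}} m(\omega)\,V_{g_1}f(x,\omega)\,\overline{V_{g_2}g(x,\omega)}\,dx\,d\omega,\qquad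 f,g\in L^2(\mathbb R^d).$$ The tempered distribution $\hat m\,\mathcal C_{g_1,g_2}$ is defined by duality: $\langle \hat m\,\mathcal C_{g_1,g_2},\varphi\rangle=\int_{\mathbb R^d} m(\omega)\,\mathcal F(\mathcal C_{g_1,g_2}\varphi)(\omega)\,d\omega$ for $\varphi\in\mathcal S(\mathbb R^d)$ (bilinear pairing). Then: 1. For every $m\in L^\infty(\mathbb R^d)$, $T_m$ and $A^{g_1,g_2}_{1\otimes m}$ are well-defined bounded linear operators on $L^2(\mathbb R^d)$ (in particular, the double integral above converges absolutely for all $f,g\in L^2(\mathbb R^d)$), the product $\hat m\,\mathcal C_{g_1,g_2}$ is a well-defined tempered distribution (in particular, $\mathcal F(\mathcal C_{g_1,g_2}\varphi)\in L^1(\mathbb R^d)$ for every $\varphi\in\mathcal S(\mathbb R^d)$), and $$A^{g_1,g_2}_{1\otimes m}=T_m\ \text{ on } L^2(\mathbb R^d)\quad\Longleftrightarrow\quad \hat m\,\mathcal C_{g_1,g_2}=\hat m\ \text{ in }\mathcal S'(\mathbb R^d).$$ 2. If $\hat m\,\mathcal C_{g_1,g_2}=\hat m$ held for every $m\in L^\infty(\mathbb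 R^d)$, then $\mathcal C_{g_1,g_2}(t)=1$ for all $t\in\mathbb R^d$. 3. However, $\mathcal C_{g_1,g_2}\in C_0(\mathbb R^d)$ (it is continuous and vanishes at infinity), so it is never identically $1$. Consequently, for every pair of windows $g_1,g_2\in L^2(\mathbb R^d)$ there is some $m\in L^\infty(\mathbb R^d)$ with $A^{g_1,g_2}_{1\otimes m}\neq T_m$ on $L^2(\mathbb R^d)$. -/

import Mathlib

open MeasureTheory FourierTransform SchwartzMap
open scoped ENNReal ComplexConjugate Convolution ZeroAtInfty

noncomputable section

/-- Euclidean space `ℝ^d` with its Lebesgue measure. -/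
abbrev Eu (d : ℕ) : Type := EuclideanSpace ℝ (Fin d)

/-- The complex Hilbert space `L²(ℝ^d)`. -/
abbrev L2 (d : ℕ) : Type := Lp ℂ 2 (volume : Measure (Eu d))

/-- The space `L^∞(ℝ^d)`. -/
abbrev Linf (d : ℕ) : Type := Lp ℂ ∞ (volume : Measure (Eu d))

/-- The Fourier multiplier `T_m f = 𝓕⁻¹ (m · 𝓕 f)` on `L²(ℝ^d)`, where `𝓕` is the (Plancherel)
Fourier transform of `L²(ℝ^d)` and `m · 𝓕 f` is the pointwise product of classes. -/
def fourierMultiplier {d : ℕ} (m : Linf d) (f : L2 d) : L2 d :=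
  𝓕⁻ ((m • (𝓕 f : L2 d) : L2 d))

/-- The short-time Fourier transform
`V_g f (x, ω) = 𝓕 (f · conj (T_x g)) (ω) = ∫ f(y) conj (g(y - x)) e^{-2πi y·ω} dy`. -/
def stft {d : ℕ} (g f : L2 d) (z : Eu d × Eu d) : ℂ :=
  𝓕 (fun y : Eu d => f y * conj (g (y - z.1))) z.2

/-- `u` is the value at `f` of the STFT multiplier with symbol `a`, analysis window `g₁` and
synthesis window `g₂`, in the weak sense: for every `g ∈ L²` the integral
`∫∫ a V_{g₁} f conj (V_{g₂} g)` converges absolutely and is equal to `⟨u, g⟩`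
(linear in `u`, conjugate-linear in `g`). -/
def IsStftMultiplierValue {d : ℕ} (a : Eu d × Eu d → ℂ) (g₁ g₂ f u : L2 d) : Prop :=
  ∀ g : L2 d,
    Integrable (fun z : Eu d × Eu d => a z * stft g₁ f z * conj (stft g₂ g z)) ∧
    inner ℂ g u = ∫ z : Eu d × Eu d, a z * stft g₁ f z * conj (stft g₂ g z)

/-- The weak definition determines the value. -/
theorem IsStftMultiplierValue.unique {d : ℕ} {a : Eu d × Eu d → ℂ} {g₁ g₂ f u v : L2 d}
    (hu : IsStftMultiplierValue a g₁ g₂ f u) (hv : IsStftMultiplierValue a g₁ g₂ f v) :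
    u = v :=
  ext_inner_left ℂ fun g => (hu g).2.trans (hv g).2.symm

/-- The STFT multiplier (localization operator) `A_a^{g₁,g₂}` on `L²(ℝ^d)`: its value at `f` is
the element of `L²` given by the weak definition (an arbitrary one if there is none). -/
def stftMultiplier {d : ℕ} (a : Eu d × Eu d → ℂ) (g₁ g₂ f : L2 d) : L2 d :=
  Classical.epsilon fun u : L2 d => IsStftMultiplierValue a g₁ g₂ f u

/-- The symbol `(1 ⊗ m)(x, ω) = m(ω)`. -/
def oneTensor {d : ℕ} (m : Linf d) (z : Eu d × Eu d) : ℂ := m z.2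

/-- The window correlation function `C_{g₁,g₂} = (I g₂) ∗ conj g₁`, where `I g (t) = g (-t)`. -/
def windowCorrelation {d : ℕ} (g₁ g₂ : L2 d) : Eu d → ℂ :=
  (fun t : Eu d => g₂ (-t)) ⋆[ContinuousLinearMap.mul ℝ ℂ, volume] (fun t : Eu d => conj (g₁ t))

/-- `P` is the tempered distribution `m̂ · c`, for `m ∈ L^∞` and a function `c`: by duality
`⟨m̂ · c, φ⟩ = ⟨m̂, c φ⟩ = ∫ m(ω) 𝓕(c φ)(ω) dω` for every Schwartz function `φ`, where
`𝓕 (c φ)` has to be integrable for the pairing with `m ∈ L^∞` to make sense. -/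
def IsFourierMul {d : ℕ} (m : Linf d) (c : Eu d → ℂ) (P : 𝓢'(Eu d, ℂ)) : Prop :=
  ∀ φ : 𝓢(Eu d, ℂ),
    Integrable (𝓕 (fun t : Eu d => c t * φ t)) ∧
    P φ = ∫ ω : Eu d, m ω * 𝓕 (fun t : Eu d => c t * φ t) ω

/-- The duality formula determines the product. -/
theorem IsFourierMul.unique {d : ℕ} {m : Linf d} {c : Eu d → ℂ} {P Q : 𝓢'(Eu d, ℂ)}
    (hP : IsFourierMul m c P) (hQ : IsFourierMul m c Q) : P = Q := by
  ext φ
  exact (hP φ).2.trans (hQ φ).2.symm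

/-- The tempered distribution `m̂ · c` (an arbitrary one if the product does not exist). -/
def fourierMul {d : ℕ} (m : Linf d) (c : Eu d → ℂ) : 𝓢'(Eu d, ℂ) :=
  Classical.epsilon fun P : 𝓢'(Eu d, ℂ) => IsFourierMul m c P

/-- The Fourier transform `m̂` of `m ∈ L^∞`, as a tempered distribution. -/
def fourierDist {d : ℕ} (m : Linf d) : 𝓢'(Eu d, ℂ) := 𝓕 (Lp.toTemperedDistribution m)

end

/-! Put `H = 𝓕 g₂ · conj (𝓕 g₁)`, an integrable function. Everything reduces to the averaged symbol
`m ∗ H`. For fixed `ω`, the STFT in `x` is, up to a phase, the inverse transform of `𝓕 f · conj (T_ω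
𝓕 g)`; Plancherel in `x` and Fubini make the STFT multiplier equal to `T_{m ∗ H}`
(`isStftMultiplierValue_fourierMultiplier`). The correlation function is `𝓕 H`, so the product `m̂ ·
C` is the transform of `m ∗ H` (`isFourierMul_averagedSymbol`). As `m ↦ T_m` and `m ↦ m̂` are
injective, both conditions say `m ∗ H = m`. A plane wave of frequency `t` satisfies `m ∗ H = C(t)
m`, which forces `C(t) = 1`; Riemann–Lebesgue for `𝓕 H` excludes this for all `t`. -/

/-! ### The integral and Plancherel Fourier transforms agree on `L¹ ∩ L²`. -/

theorem ae_eq_of_forall_integral_schwartz {d : ℕ} {f g : Eu d → ℂ}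
    (hf : LocallyIntegrable f) (hg : LocallyIntegrable g)
    (h : ∀ φ : 𝓢(Eu d, ℂ), ∫ x, φ x * f x = ∫ x, φ x * g x) : f =ᵐ[volume] g := by
  refine ae_eq_of_integral_contDiff_smul_eq hf hg fun φ hφ hc => ?_
  have h₁ : HasCompactSupport (Complex.ofRealCLM ∘ φ) := hc.comp_left rfl
  have h₂ : ContDiff ℝ (⊤ : ℕ∞) (Complex.ofRealCLM ∘ φ) := by fun_prop
  simpa using h (h₁.toSchwartzMap h₂)

theorem continuous_fourier_of_integrable {d : ℕ} {f : Eu d → ℂ} (hf : Integrable f) :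
    Continuous (𝓕 f) :=
  VectorFourier.fourierIntegral_continuous Real.continuous_fourierChar
    (innerSL ℝ).continuous₂ hf

theorem integral_fourier_mul {d : ℕ} {f g : Eu d → ℂ} (hf : Integrable f) (hg : Integrable g) :
    ∫ x, 𝓕 f x * g x = ∫ x, f x * 𝓕 g x := by
  have := VectorFourier.integral_fourierIntegral_smul_eq_flip (L := innerₗ (Eu d))
    Real.continuous_fourierChar continuous_inner hf (μ := volume) hg
  rw [flip_innerₗ] at this
  simpa only [smul_eq_mul] using! this

theorem integral_schwartz_fourier_mul {d : ℕ} {f : Eu d → ℂ} (hf : Integrable f)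
    (φ : 𝓢(Eu d, ℂ)) : ∫ x, (𝓕 φ : 𝓢(Eu d, ℂ)) x * f x = ∫ x, φ x * 𝓕 f x := by
  rw [SchwartzMap.fourier_coe, integral_fourier_mul φ.integrable hf]

theorem integral_schwartz_fourierInv_mul {d : ℕ} {f : Eu d → ℂ} (hf : Integrable f)
    (φ : 𝓢(Eu d, ℂ)) : ∫ x, (𝓕⁻ φ : 𝓢(Eu d, ℂ)) x * f x = ∫ x, φ x * 𝓕⁻ f x := by
  rw [Real.fourierInv_eq_fourier_comp_neg, ← integral_schwartz_fourier_mul hf.comp_neg,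
    ← integral_neg_eq_self]
  simp only [SchwartzMap.fourier_coe, SchwartzMap.fourierInv_coe, Real.fourierInv_eq_fourier_neg,
    neg_neg]

theorem coeFn_fourier_toLp {d : ℕ} {f : Eu d → ℂ} (h₁ : Integrable f) (h₂ : MemLp f 2) :
    (𝓕 (h₂.toLp f : L2 d) : L2 d) =ᵐ[volume] 𝓕 f := by
  refine ae_eq_of_forall_integral_schwartz ((Lp.memLp _).locallyIntegrable (by norm_num))
    (continuous_fourier_of_integrable h₁).locallyIntegrable fun φ => ?_
  have := DFunLike.congr_fun (Lp.fourier_toTemperedDistribution_eq (h₂.toLp f : L2 d)) φ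
  rw [TemperedDistribution.fourier_apply, Lp.toTemperedDistribution_apply,
    Lp.toTemperedDistribution_apply] at this
  simp only [smul_eq_mul] at this
  rw [← this, ← integral_schwartz_fourier_mul h₁]
  exact integral_congr_ae (h₂.coeFn_toLp.mono fun x hx => by simp only [hx])

theorem coeFn_fourierInv_toLp {d : ℕ} {f : Eu d → ℂ} (h₁ : Integrable f) (h₂ : MemLp f 2) :
    (𝓕⁻ (h₂.toLp f : L2 d) : L2 d) =ᵐ[volume] 𝓕⁻ f := by
  have hc : Continuous (𝓕⁻ f) := by
    rw [Real.fourierInv_eq_fourier_comp_neg]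
    exact continuous_fourier_of_integrable h₁.comp_neg
  refine ae_eq_of_forall_integral_schwartz ((Lp.memLp _).locallyIntegrable (by norm_num))
    hc.locallyIntegrable fun φ => ?_
  have := DFunLike.congr_fun (Lp.fourierInv_toTemperedDistribution_eq (h₂.toLp f : L2 d)) φ
  rw [TemperedDistribution.fourierInv_apply, Lp.toTemperedDistribution_apply,
    Lp.toTemperedDistribution_apply] at this
  simp only [smul_eq_mul] at this
  rw [← this, ← integral_schwartz_fourierInv_mul h₁]
  exact integral_congr_ae (h₂.coeFn_toLp.mono fun x hx => by simp only [hx])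

/-! ### Plane waves and time-frequency shifts. -/

/-- The plane wave `y ↦ e^{2πi y·ω}`. -/
noncomputable def planeWave {d : ℕ} (ω y : Eu d) : ℂ :=
  Complex.exp (2 * Real.pi * (inner ℝ y ω : ℝ) * Complex.I)

@[fun_prop]
theorem continuous_planeWave {d : ℕ} {α : Type*} [TopologicalSpace α] {f g : α → Eu d}
    (hf : Continuous f) (hg : Continuous g) : Continuous fun a => planeWave (f a) (g a) := by
  unfold planeWave
  fun_prop

@[simp]
theorem norm_planeWave {d : ℕ} (ω y : Eu d) : ‖planeWave ω y‖ = 1 := by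
  rw [planeWave, ← Complex.ofReal_ofNat, ← Complex.ofReal_mul, ← Complex.ofReal_mul,
    Complex.norm_exp_ofReal_mul_I]

theorem planeWave_comm {d : ℕ} (ω y : Eu d) : planeWave ω y = planeWave y ω := by
  rw [planeWave, planeWave, real_inner_comm]

theorem conj_planeWave {d : ℕ} (ω y : Eu d) : conj (planeWave ω y) = planeWave (-ω) y := by
  simp [planeWave, ← Complex.exp_conj, inner_neg_right, Complex.conj_ofNat]

theorem planeWave_add {d : ℕ} (ω η y : Eu d) :
    planeWave (ω + η) y = planeWave ω y * planeWave η y := by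
  simp only [planeWave, ← Complex.exp_add, inner_add_right]
  congr 1
  push_cast
  ring

theorem planeWave_add_right {d : ℕ} (ω y z : Eu d) :
    planeWave ω (y + z) = planeWave ω y * planeWave ω z := by
  rw [planeWave_comm, planeWave_add, planeWave_comm y, planeWave_comm z]

theorem planeWave_neg_right {d : ℕ} (ω y : Eu d) : planeWave ω (-y) = planeWave (-ω) y := by
  simp [planeWave, inner_neg_left, inner_neg_right]

theorem planeWave_mul_neg {d : ℕ} (ω y : Eu d) : planeWave ω y * planeWave (-ω) y = 1 := by
  rw [← planeWave_add, add_neg_cancel]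
  simp [planeWave]

theorem fourier_eq_planeWave {d : ℕ} (f : Eu d → ℂ) (ω : Eu d) :
    𝓕 f ω = ∫ y, planeWave (-ω) y * f y := by
  rw [Real.fourier_eq']
  refine integral_congr_ae (.of_forall fun y => ?_)
  simp [planeWave, inner_neg_right]

theorem fourierInv_eq_planeWave {d : ℕ} (f : Eu d → ℂ) (ω : Eu d) :
    𝓕⁻ f ω = ∫ y, planeWave ω y * f y := by
  rw [Real.fourierInv_eq_fourier_neg, fourier_eq_planeWave, neg_neg]

/-- The plane wave of frequency `ω`, as an element of `L^∞`. -/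
noncomputable def planeWaveLinf {d : ℕ} (ω : Eu d) : Linf d :=
  MemLp.toLp (planeWave ω) (memLp_top_of_bound (by fun_prop) 1 (by simp))

theorem coeFn_planeWaveLinf {d : ℕ} (ω : Eu d) : planeWaveLinf ω =ᵐ[volume] planeWave ω :=
  MemLp.coeFn_toLp _

/-- Translation by `x` on `L²`. -/
noncomputable def translateL2 {d : ℕ} (x : Eu d) (g : L2 d) : L2 d :=
  Lp.compMeasurePreserving (fun y => y - x) (measurePreserving_sub_right volume x) g

theorem coeFn_translateL2 {d : ℕ} (x : Eu d) (g : L2 d) :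
    translateL2 x g =ᵐ[volume] fun y => g (y - x) :=
  Lp.coeFn_compMeasurePreserving _ _

theorem continuous_translateL2 {d : ℕ} (x : Eu d) : Continuous (translateL2 x) :=
  (Lp.isometry_compMeasurePreserving _).continuous

theorem isBoundedLinearMap_linf_smul {d : ℕ} (m : Linf d) :
    IsBoundedLinearMap ℂ (fun f : L2 d => (m • f : L2 d)) :=
  IsLinearMap.with_bound ⟨fun f g => Lp.add_smul .., fun c f => by
    ext
    filter_upwards [Lp.coeFn_lpSMul (r := 2) m (c • f), Lp.coeFn_lpSMul (r := 2) m f,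
      Lp.coeFn_smul c f, Lp.coeFn_smul c (m • f : L2 d)] with x h₁ h₂ h₃ h₄
    rw [h₁, h₄, Pi.smul_apply', Pi.smul_apply, h₂, h₃, Pi.smul_apply, Pi.smul_apply', smul_comm]⟩ ‖m‖
    fun f => Lp.norm_smul_le ..

/-- The time-frequency shift `M_ω T_x` on `L²`. -/
noncomputable def timeFreqShift {d : ℕ} (x ω : Eu d) (g : L2 d) : L2 d :=
  planeWaveLinf ω • translateL2 x g

theorem coeFn_timeFreqShift {d : ℕ} (x ω : Eu d) (g : L2 d) :
    timeFreqShift x ω g =ᵐ[volume]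
      fun y => planeWave ω y * g (y - x) := by
  filter_upwards [Lp.coeFn_lpSMul (r := 2) (planeWaveLinf ω) (translateL2 x g), coeFn_planeWaveLinf ω,
    coeFn_translateL2 x g] with y h₁ h₂ h₃
  rw [timeFreqShift, h₁, Pi.smul_apply', h₂, h₃, smul_eq_mul]

theorem continuous_timeFreqShift {d : ℕ} (x ω : Eu d) : Continuous (timeFreqShift x ω) :=
  (isBoundedLinearMap_linf_smul _).continuous.comp (continuous_translateL2 x)

/-- Both sides are continuous in `g`, so Schwartz `g` suffice; there it is a change of variables in
the integral. -/
theorem fourier_timeFreqShift {d : ℕ} (x ω : Eu d) (g : L2 d) :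
    (𝓕 (timeFreqShift x ω g) : L2 d) = translateL2 ω (planeWaveLinf (-x) • (𝓕 g : L2 d) : L2 d) := by
  refine DenseRange.induction_on (SchwartzMap.denseRange_toLpCLM (p := 2) ENNReal.ofNat_ne_top) g
    (isClosed_eq ?_ ?_) fun φ => ?_
  · exact (fourierCLM ℂ (L2 d)).continuous.comp (continuous_timeFreqShift x ω)
  · exact (continuous_translateL2 ω).comp ((isBoundedLinearMap_linf_smul _).continuous.comp
      (fourierCLM ℂ (L2 d)).continuous)
  rw [SchwartzMap.toLpCLM_apply]
  set u := timeFreqShift x ω (φ.toLp 2) with hu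
  have hsub := (measurePreserving_sub_right volume x).quasiMeasurePreserving
  have hu' : u =ᵐ[volume] fun y => planeWave ω y * φ (y - x) := by
    filter_upwards [coeFn_timeFreqShift x ω (φ.toLp 2), hsub.ae (φ.coeFn_toLp 2 volume)] with y h₁ h₂
    rw [h₁, h₂]
  have hi : Integrable u := by
    refine Integrable.congr ?_ hu'.symm
    exact (φ.integrable.comp_sub_right x).bdd_mul (c := 1) (by fun_prop) (by simp)
  have key := coeFn_fourier_toLp hi (Lp.memLp u)
  rw [Lp.toLp_coeFn] at key
  have hsub' := (measurePreserving_sub_right volume ω).quasiMeasurePreserving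
  ext
  filter_upwards [key, coeFn_translateL2 ω (planeWaveLinf (-x) • (𝓕 (φ.toLp 2) : L2 d) : L2 d),
    hsub'.ae (Lp.coeFn_lpSMul (r := 2) (planeWaveLinf (-x)) (𝓕 (φ.toLp 2) : L2 d)),
    hsub'.ae (coeFn_planeWaveLinf (-x)), hsub'.ae ((𝓕 φ).coeFn_toLp 2 volume)] with ξ h₁ h₂ h₃ h₄ h₅
  rw [h₁, h₂, h₃, Pi.smul_apply', h₄, SchwartzMap.toLp_fourier_eq, h₅, Real.fourier_congr_ae hu',
    SchwartzMap.fourier_coe, fourier_eq_planeWave, fourier_eq_planeWave, smul_eq_mul,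
    ← integral_const_mul, ← integral_add_right_eq_self _ x]
  refine integral_congr_ae (.of_forall fun y => ?_)
  simp only [add_sub_cancel_right, ← mul_assoc]
  congr 1
  simp only [planeWave, ← Complex.exp_add]
  congr 1
  simp only [inner_add_left, inner_sub_right, inner_neg_right,
    real_inner_comm x]
  push_cast
  ring

/-! ### The STFT on the frequency side. -/

theorem stft_eq_inner {d : ℕ} (g f : L2 d) (x ω : Eu d) :
    stft g f (x, ω) = inner ℂ (timeFreqShift x ω g) f := by
  rw [stft, fourier_eq_planeWave, L2.inner_def]
  refine integral_congr_ae ?_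
  filter_upwards [coeFn_timeFreqShift x ω g] with y hy
  rw [hy, RCLike.inner_apply, map_mul, conj_planeWave]
  ring

/-- The product `𝓕 f · conj (T_ω 𝓕 g)`. -/
noncomputable def crossSpectrum {d : ℕ} (g f : L2 d) (ω ξ : Eu d) : ℂ :=
  (𝓕 f : L2 d) ξ * conj ((𝓕 g : L2 d) (ξ - ω))

theorem integrable_crossSpectrum {d : ℕ} (g f : L2 d) (ω : Eu d) :
    Integrable (crossSpectrum g f ω) :=
  (Lp.memLp (𝓕 f : L2 d)).integrable_mul
    ((Lp.memLp (𝓕 g : L2 d)).comp_measurePreserving (measurePreserving_sub_right volume ω)).star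

/-- Parseval applied to `⟨M_ω T_x g, f⟩`. This exposes the dependence on `x` as an inverse
transform, ready for Plancherel in `x`. -/
theorem stft_eq_fourierInv {d : ℕ} (g f : L2 d) (x ω : Eu d) :
    stft g f (x, ω) = planeWave (-ω) x * 𝓕⁻ (crossSpectrum g f ω) x := by
  rw [stft_eq_inner, ← Lp.inner_fourier_eq, fourier_timeFreqShift, L2.inner_def,
    fourierInv_eq_planeWave, ← integral_const_mul]
  refine integral_congr_ae ?_
  have hsub := (measurePreserving_sub_right volume ω).quasiMeasurePreserving
  filter_upwards [coeFn_translateL2 ω (planeWaveLinf (-x) • (𝓕 g : L2 d) : L2 d),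
    hsub.ae (Lp.coeFn_lpSMul (r := 2) (planeWaveLinf (-x)) (𝓕 g : L2 d)),
    hsub.ae (coeFn_planeWaveLinf (-x))] with ξ h₁ h₂ h₃
  rw [h₁, h₂, Pi.smul_apply', h₃, RCLike.inner_apply, smul_eq_mul, map_mul, conj_planeWave,
    neg_neg, sub_eq_add_neg, planeWave_add_right, ← sub_eq_add_neg, crossSpectrum,
    planeWave_neg_right, planeWave_comm (-x), planeWave_neg_right]
  ring

theorem stronglyMeasurable_stft {d : ℕ} (g f : L2 d) : StronglyMeasurable (stft g f) := by
  have hf := Lp.stronglyMeasurable f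
  have hg := Lp.stronglyMeasurable g
  have : StronglyMeasurable fun p : (Eu d × Eu d) × Eu d =>
      planeWave (-p.1.2) p.2 * (f p.2 * conj (g (p.2 - p.1.1))) := by
    refine (Continuous.stronglyMeasurable (by fun_prop)).mul
      ((hf.comp_measurable measurable_snd).mul ?_)
    exact (hg.comp_measurable (by fun_prop :
      Measurable fun p : (Eu d × Eu d) × Eu d => p.2 - p.1.1)).star
  have h := this.integral_prod_right' (ν := volume)
  convert h using 1
  ext z
  rw [stft, fourier_eq_planeWave]

theorem integral_fourierInv_mul_conj {d : ℕ} {u v : Eu d → ℂ} (hu : Integrable u)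
    (hu' : MemLp u 2) (hv : Integrable v) (hv' : MemLp v 2) :
    ∫ x, 𝓕⁻ u x * conj (𝓕⁻ v x) = ∫ x, u x * conj (v x) := by
  have h : inner ℂ (𝓕⁻ (hv'.toLp v : L2 d) : L2 d) (𝓕⁻ (hu'.toLp u : L2 d))
      = inner ℂ (hv'.toLp v : L2 d) (hu'.toLp u) := by
    rw [← Lp.inner_fourier_eq, fourier_fourierInv_eq, fourier_fourierInv_eq]
  rw [L2.inner_def, L2.inner_def] at h
  convert h using 1
  · refine integral_congr_ae ?_
    filter_upwards [coeFn_fourierInv_toLp hu hu', coeFn_fourierInv_toLp hv hv'] with x h₁ h₂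
    rw [h₁, h₂, RCLike.inner_apply]
  · refine integral_congr_ae ?_
    filter_upwards [hu'.coeFn_toLp, hv'.coeFn_toLp] with x h₁ h₂
    rw [h₁, h₂, RCLike.inner_apply]

theorem memLp_fourierInv {d : ℕ} {u : Eu d → ℂ} (hu : Integrable u) (hu' : MemLp u 2) :
    MemLp (𝓕⁻ u) 2 :=
  (memLp_congr_ae (coeFn_fourierInv_toLp hu hu')).1 (Lp.memLp _)

theorem integral_norm_sq_fourierInv {d : ℕ} {u : Eu d → ℂ} (hu : Integrable u)
    (hu' : MemLp u 2) : ∫ x, ‖𝓕⁻ u x‖ ^ 2 = ∫ x, ‖u x‖ ^ 2 := by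
  have h := integral_fourierInv_mul_conj hu hu' hu hu'
  simp only [Complex.mul_conj', ← Complex.ofReal_pow, integral_complex_ofReal] at h
  exact_mod_cast h

theorem integrable_prod_norm_sq_crossSpectrum {d : ℕ} (g f : L2 d) :
    Integrable fun p : Eu d × Eu d => ‖crossSpectrum g f p.1 p.2‖ ^ 2 := by
  have hf : Integrable fun ξ => ‖(𝓕 f : L2 d) ξ‖ ^ 2 := (Lp.memLp _).integrable_norm_pow two_ne_zero
  have hg : Integrable fun ξ => ‖(𝓕 g : L2 d) (-ξ)‖ ^ 2 :=
    ((Lp.memLp (𝓕 g : L2 d)).integrable_norm_pow two_ne_zero).comp_neg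
  -- The function is the integrand of the convolution of `|𝓕 f|²` with the reflection of `|𝓕 g|²`.
  refine (hf.convolution_integrand (ContinuousLinearMap.mul ℝ ℝ) hg).congr
    (.of_forall fun p => ?_)
  simp [crossSpectrum, mul_pow]

theorem aestronglyMeasurable_crossSpectrum {d : ℕ} (g f : L2 d) (ω : Eu d) :
    AEStronglyMeasurable (crossSpectrum g f ω) :=
  (integrable_crossSpectrum g f ω).aestronglyMeasurable

theorem ae_memLp_crossSpectrum {d : ℕ} (g f : L2 d) :
    ∀ᵐ ω : Eu d, MemLp (crossSpectrum g f ω) 2 := by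
  filter_upwards [(integrable_prod_norm_sq_crossSpectrum g f).prod_right_ae] with ω hω
  exact (memLp_two_iff_integrable_sq_norm (aestronglyMeasurable_crossSpectrum g f ω)).2 hω

theorem norm_stft_eq {d : ℕ} (g f : L2 d) (x ω : Eu d) :
    ‖stft g f (x, ω)‖ = ‖𝓕⁻ (crossSpectrum g f ω) x‖ := by
  rw [stft_eq_fourierInv, norm_mul, norm_planeWave, one_mul]

/-- Tonelli with `x` integrated first: Plancherel in `x` turns each slice norm into that of the
cross spectrum. -/
theorem memLp_stft {d : ℕ} (g f : L2 d) : MemLp (stft g f) 2 := by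
  have hm := (stronglyMeasurable_stft g f).aestronglyMeasurable (μ := volume)
  rw [memLp_two_iff_integrable_sq_norm hm]
  refine (integrable_prod_iff' (hm.norm.pow 2)).2 ⟨?_, ?_⟩
  · filter_upwards [ae_memLp_crossSpectrum g f] with ω hω
    simp only [Pi.pow_apply, norm_stft_eq]
    exact (memLp_fourierInv (integrable_crossSpectrum g f ω) hω).integrable_norm_pow two_ne_zero
  · refine (integrable_prod_norm_sq_crossSpectrum g f).integral_prod_left.congr ?_
    filter_upwards [ae_memLp_crossSpectrum g f] with ω hω
    simp only [Pi.pow_apply, norm_stft_eq, norm_pow, norm_norm]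
    rw [integral_norm_sq_fourierInv (integrable_crossSpectrum g f ω) hω]

/-- The phases cancel, and after Plancherel the four factors regroup: signals at `ξ`, windows at `ξ
- ω`. Only almost every `ω` has square-integrable cross spectra. -/
theorem integral_stft_mul_conj {d : ℕ} (g₁ g₂ f g : L2 d) :
    ∀ᵐ ω : Eu d, ∫ x, stft g₁ f (x, ω) * conj (stft g₂ g (x, ω)) =
      ∫ ξ, crossSpectrum g f 0 ξ * crossSpectrum g₁ g₂ 0 (ξ - ω) := by
  filter_upwards [ae_memLp_crossSpectrum g₁ f, ae_memLp_crossSpectrum g₂ g] with ω h₁ h₂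
  have h := integral_fourierInv_mul_conj (integrable_crossSpectrum g₁ f ω) h₁
    (integrable_crossSpectrum g₂ g ω) h₂
  convert h using 1
  · refine integral_congr_ae (.of_forall fun x => ?_)
    simp only [stft_eq_fourierInv, map_mul, conj_planeWave]
    linear_combination (𝓕⁻ (crossSpectrum g₁ f ω) x * conj (𝓕⁻ (crossSpectrum g₂ g ω) x)) *
      planeWave_mul_neg (-ω) x
  · refine integral_congr_ae (.of_forall fun x => ?_)
    simp only [crossSpectrum, sub_zero, map_mul, Complex.conj_conj]
    ring

/-! ### Convolution of `L^∞` with `L¹`, and the averaged symbol. -/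

theorem norm_linf_apply_le {d : ℕ} (m : Linf d) : ∀ᵐ ω : Eu d, ‖m ω‖ ≤ ‖m‖ := by
  have := ae_le_eLpNormEssSup (f := m) (μ := volume)
  filter_upwards [this] with ω hω
  rw [Lp.norm_def, eLpNorm_exponent_top]
  have hfin : eLpNormEssSup m volume ≠ ∞ := by
    rw [← eLpNorm_exponent_top]
    exact Lp.eLpNorm_ne_top m
  simpa using ENNReal.toReal_mono hfin hω

theorem memLp_convolution_linf {d : ℕ} (m : Linf d) {h : Eu d → ℂ} (hh : Integrable h) :
    MemLp (fun ξ => ∫ ω, m ω * h (ξ - ω)) ∞ volume := by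
  refine memLp_top_of_bound ?_ (∫ ω, ‖m‖ * ‖h ω‖) (.of_forall fun ξ => ?_)
  · exact ((Lp.aestronglyMeasurable m).convolution_integrand (ContinuousLinearMap.mul ℝ ℂ)
      hh.aestronglyMeasurable).integral_prod_right'
  · rw [← integral_sub_left_eq_self (fun ω => ‖m‖ * ‖h ω‖) volume ξ]
    refine norm_integral_le_of_norm_le ((hh.norm.comp_sub_left ξ).const_mul _) ?_
    filter_upwards [norm_linf_apply_le m] with ω hω
    rw [norm_mul]
    gcongr

/-- The convolution of `m ∈ L^∞` with an integrable function. -/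
noncomputable def convLinf {d : ℕ} (m : Linf d) {h : Eu d → ℂ} (hh : Integrable h) : Linf d :=
  (memLp_convolution_linf m hh).toLp _

theorem coeFn_convLinf {d : ℕ} (m : Linf d) {h : Eu d → ℂ} (hh : Integrable h) :
    convLinf m hh =ᵐ[volume] fun ξ => ∫ ω, m ω * h (ξ - ω) :=
  MemLp.coeFn_toLp _

theorem integrable_prod_mul_sub {d : ℕ} {f h : Eu d → ℂ} (hf : Integrable f)
    (hh : Integrable h) : Integrable fun p : Eu d × Eu d => f p.2 * h (p.2 - p.1) := by
  refine (hf.convolution_integrand (ContinuousLinearMap.mul ℝ ℂ) hh.comp_neg).congr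
    (.of_forall fun p => ?_)
  simp

theorem integral_linf_mul_correlation {d : ℕ} (m : Linf d) {f h : Eu d → ℂ}
    (hf : Integrable f) (hh : Integrable h) :
    ∫ ω, m ω * ∫ ξ, f ξ * h (ξ - ω) = ∫ ξ, f ξ * convLinf m hh ξ := by
  have hi : Integrable fun p : Eu d × Eu d => m p.1 * (f p.2 * h (p.2 - p.1)) :=
    (integrable_prod_mul_sub hf hh).bdd_mul (Lp.aestronglyMeasurable m).comp_fst
      (Measure.quasiMeasurePreserving_fst.ae (norm_linf_apply_le m))
  simp only [← integral_const_mul]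
  rw [integral_integral_swap hi]
  refine integral_congr_ae ?_
  filter_upwards [coeFn_convLinf m hh] with ξ hξ
  rw [hξ, ← integral_const_mul]
  refine integral_congr_ae (.of_forall fun ω => ?_)
  simp only
  ring

/-- `𝓕 g₂ · conj (𝓕 g₁)`, the inverse Fourier transform of the window correlation function. -/
noncomputable abbrev windowSpectrum {d : ℕ} (g₁ g₂ : L2 d) : Eu d → ℂ := crossSpectrum g₁ g₂ 0

/-- The symbol `m ∗ (𝓕 g₂ · conj (𝓕 g₁))`. -/
noncomputable def averagedSymbol {d : ℕ} (g₁ g₂ : L2 d) (m : Linf d) : Linf d :=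
  convLinf m (integrable_crossSpectrum g₁ g₂ 0)

/-! ### The correlation function and the product `m̂ · C`. -/

theorem windowCorrelation_eq_stft {d : ℕ} (g₁ g₂ : L2 d) (t : Eu d) :
    windowCorrelation g₁ g₂ t = stft g₁ g₂ (-t, 0) := by
  rw [windowCorrelation, convolution_def, stft, fourier_eq_planeWave, ← integral_neg_eq_self]
  refine integral_congr_ae (.of_forall fun y => ?_)
  simp [planeWave, add_comm]

theorem windowCorrelation_eq_fourier {d : ℕ} (g₁ g₂ : L2 d) :
    windowCorrelation g₁ g₂ = 𝓕 (windowSpectrum g₁ g₂) := by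
  ext t
  rw [windowCorrelation_eq_stft, stft_eq_fourierInv, Real.fourierInv_eq_fourier_neg]
  simp [planeWave]

/-- The multiplication formula moves `𝓕` from `h` to the modulated `f`, whose transform is a
translate of `𝓕 f`. -/
theorem fourier_mul_fourier {d : ℕ} {f h : Eu d → ℂ} (hf : Integrable f) (hh : Integrable h)
    (ω : Eu d) : 𝓕 (fun t => 𝓕 h t * f t) ω = ∫ ξ, 𝓕 f ξ * h (ξ - ω) := by
  have hf' : Integrable fun t => planeWave (-ω) t * f t :=
    hf.bdd_mul (c := 1) (by fun_prop) (by simp)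
  calc _ = ∫ t, planeWave (-ω) t * f t * 𝓕 h t := by
        rw [fourier_eq_planeWave]
        exact integral_congr_ae (.of_forall fun t => by simp only; ring)
    _ = ∫ ξ, 𝓕 f (ξ + ω) * h ξ := by
        rw [← integral_fourier_mul hf' hh]
        refine integral_congr_ae (.of_forall fun ξ => ?_)
        simp only [fourier_eq_planeWave, ← mul_assoc, ← planeWave_add, neg_add]
    _ = _ := by
        rw [← integral_sub_right_eq_self _ ω]
        simp

theorem fourier_windowCorrelation_mul {d : ℕ} (g₁ g₂ : L2 d) (φ : 𝓢(Eu d, ℂ)) (ω : Eu d) :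
    𝓕 (fun t => windowCorrelation g₁ g₂ t * φ t) ω =
      ∫ ξ, (𝓕 φ : 𝓢(Eu d, ℂ)) ξ * windowSpectrum g₁ g₂ (ξ - ω) := by
  rw [windowCorrelation_eq_fourier, fourier_mul_fourier φ.integrable
    (integrable_crossSpectrum g₁ g₂ 0), SchwartzMap.fourier_coe]

theorem isFourierMul_averagedSymbol {d : ℕ} (g₁ g₂ : L2 d) (m : Linf d) :
    IsFourierMul m (windowCorrelation g₁ g₂) (fourierDist (averagedSymbol g₁ g₂ m)) := by
  intro φ
  have hφ := (𝓕 φ : 𝓢(Eu d, ℂ)).integrable (μ := volume)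
  have hH := integrable_crossSpectrum g₁ g₂ 0
  have h : 𝓕 (fun t => windowCorrelation g₁ g₂ t * φ t) = _ :=
    funext (fourier_windowCorrelation_mul g₁ g₂ φ)
  rw [h]
  refine ⟨(integrable_prod_mul_sub hφ hH).integral_prod_left, ?_⟩
  rw [integral_linf_mul_correlation m hφ hH, fourierDist, TemperedDistribution.fourier_apply,
    Lp.toTemperedDistribution_apply]
  rfl

theorem fourierMul_windowCorrelation {d : ℕ} (g₁ g₂ : L2 d) (m : Linf d) :
    fourierMul m (windowCorrelation g₁ g₂) = fourierDist (averagedSymbol g₁ g₂ m) :=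
  (Classical.epsilon_spec (p := IsFourierMul m (windowCorrelation g₁ g₂))
    ⟨_, isFourierMul_averagedSymbol g₁ g₂ m⟩).unique (isFourierMul_averagedSymbol g₁ g₂ m)

theorem fourierDist_injective {d : ℕ} : Function.Injective (fourierDist (d := d)) := by
  intro m n h
  have h' := congrArg (fun P : 𝓢'(Eu d, ℂ) => 𝓕⁻ P) h
  simp only [fourierDist, fourierInv_fourier_eq] at h'
  exact LinearMap.ker_eq_bot.1
    (Lp.ker_toTemperedDistributionCLM_eq_bot (F := ℂ) (μ := (volume : Measure (Eu d))) (p := ∞)) h'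

/-! ### Both operators as Fourier multipliers. -/

theorem isBoundedLinearMap_fourierMultiplier {d : ℕ} (m : Linf d) :
    IsBoundedLinearMap ℂ (fourierMultiplier m) :=
  (fourierInvCLM ℂ (L2 d)).isBoundedLinearMap.comp
    ((isBoundedLinearMap_linf_smul m).comp (fourierCLM ℂ (L2 d)).isBoundedLinearMap)

theorem inner_fourierMultiplier {d : ℕ} (m : Linf d) (f g : L2 d) :
    inner ℂ g (fourierMultiplier m f) = ∫ ξ, crossSpectrum g f 0 ξ * m ξ := by
  rw [← Lp.inner_fourier_eq, fourierMultiplier, fourier_fourierInv_eq, L2.inner_def]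
  refine integral_congr_ae ?_
  filter_upwards [Lp.coeFn_lpSMul (r := 2) m (𝓕 f : L2 d)] with ξ hξ
  rw [hξ, RCLike.inner_apply, Pi.smul_apply', smul_eq_mul, crossSpectrum, sub_zero]
  ring

theorem exists_l2_ae_ne_zero (d : ℕ) : ∃ u : L2 d, ∀ᵐ x : Eu d, u x ≠ 0 := by
  have h : MemLp (fun x : Eu d => Complex.exp (-1 * ‖x‖ ^ 2 + 0 * (inner ℝ 0 x : ℝ))) 2 volume := by
    rw [memLp_two_iff_integrable_sq_norm (Continuous.aestronglyMeasurable (by fun_prop))]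
    -- Squaring the modulus of the Gaussian doubles the exponent, hence `b = 2`.
    refine (GaussianFourier.integrable_cexp_neg_mul_sq_norm_add (V := Eu d) (b := 2)
      (by simp) 0 0).norm.congr (.of_forall fun x => ?_)
    simp only [Complex.norm_exp, ← Real.exp_nat_mul]
    congr 1
    simp [← Complex.ofReal_pow]
  refine ⟨h.toLp _, ?_⟩
  filter_upwards [h.coeFn_toLp] with x hx
  rw [hx]
  exact Complex.exp_ne_zero _

/-- Testing on `𝓕⁻ u`, with `u` nonzero almost everywhere, allows division by `u`. -/
theorem fourierMultiplier_injective {d : ℕ} :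
    Function.Injective (fourierMultiplier (d := d)) := by
  intro m n h
  obtain ⟨u, hu⟩ := exists_l2_ae_ne_zero d
  have h' : (m • u : L2 d) = n • u := by
    have := congrArg (fun f : L2 d => (𝓕 f : L2 d)) (congrFun h (𝓕⁻ u))
    simpa only [fourierMultiplier, fourier_fourierInv_eq] using this
  ext
  filter_upwards [hu, Lp.coeFn_lpSMul (r := 2) m u, Lp.coeFn_lpSMul (r := 2) n u] with x h₁ h₂ h₃
  rw [h', h₃] at h₂
  exact (mul_right_cancel₀ h₁ h₂).symm

theorem isStftMultiplierValue_fourierMultiplier {d : ℕ} (g₁ g₂ : L2 d) (m : Linf d) (f : L2 d) :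
    IsStftMultiplierValue (oneTensor m) g₁ g₂ f
      (fourierMultiplier (averagedSymbol g₁ g₂ m) f) := by
  intro g
  have hV : Integrable fun z => stft g₁ f z * conj (stft g₂ g z) :=
    (memLp_stft g₁ f).integrable_mul (memLp_stft g₂ g).star
  have hi : Integrable fun z : Eu d × Eu d =>
      oneTensor m z * stft g₁ f z * conj (stft g₂ g z) := by
    simp only [mul_assoc]
    exact hV.bdd_mul (Lp.aestronglyMeasurable m).comp_snd
      (Measure.quasiMeasurePreserving_snd.ae (norm_linf_apply_le m))
  refine ⟨hi, ?_⟩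
  rw [inner_fourierMultiplier, averagedSymbol, ← integral_linf_mul_correlation m
    (integrable_crossSpectrum g f 0), Measure.volume_eq_prod, integral_prod_symm _ hi]
  refine integral_congr_ae ?_
  filter_upwards [integral_stft_mul_conj g₁ g₂ f g] with ω hω
  rw [← hω, ← integral_const_mul]
  simp only [oneTensor, mul_assoc]

theorem stftMultiplier_oneTensor {d : ℕ} (g₁ g₂ : L2 d) (m : Linf d) :
    stftMultiplier (oneTensor m) g₁ g₂ = fourierMultiplier (averagedSymbol g₁ g₂ m) :=
  funext fun f => (Classical.epsilon_spec (p := IsStftMultiplierValue (oneTensor m) g₁ g₂ f)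
    ⟨_, isStftMultiplierValue_fourierMultiplier g₁ g₂ m f⟩).unique
      (isStftMultiplierValue_fourierMultiplier g₁ g₂ m f)

/-! ### Plane waves as test symbols; decay of the correlation function. -/

theorem averagedSymbol_planeWave {d : ℕ} (g₁ g₂ : L2 d) (t : Eu d) :
    averagedSymbol g₁ g₂ (planeWaveLinf t) =ᵐ[volume]
      fun ξ => windowCorrelation g₁ g₂ t * planeWave t ξ := by
  filter_upwards [coeFn_convLinf (planeWaveLinf t) (integrable_crossSpectrum g₁ g₂ 0)] with ξ hξ
  rw [averagedSymbol, hξ, windowCorrelation_eq_fourier, fourier_eq_planeWave,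
    ← integral_mul_const, ← integral_sub_left_eq_self
      (fun ω => planeWave (-t) ω * windowSpectrum g₁ g₂ ω * planeWave t ξ) volume ξ]
  refine integral_congr_ae ?_
  filter_upwards [coeFn_planeWaveLinf t] with ω hω
  rw [hω, mul_right_comm, sub_eq_add_neg, planeWave_add_right, planeWave_neg_right, neg_neg]
  linear_combination (-planeWave t ω * windowSpectrum g₁ g₂ (ξ + -ω)) * planeWave_mul_neg t ξ

/-- The window correlation function is in `C₀`. -/
theorem exists_zeroAtInfty_windowCorrelation {d : ℕ} (g₁ g₂ : L2 d) :
    ∃ F : C₀(Eu d, ℂ), ∀ t : Eu d, F t = windowCorrelation g₁ g₂ t := by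
  rw [windowCorrelation_eq_fourier]
  exact ⟨⟨⟨_, continuous_fourier_of_integrable (integrable_crossSpectrum g₁ g₂ 0)⟩,
    tendsto_integral_exp_inner_smul_cocompact _⟩, fun t => rfl⟩

theorem not_forall_windowCorrelation_eq_one {d : ℕ} (hd : 0 < d) (g₁ g₂ : L2 d) :
    ¬ ∀ t : Eu d, windowCorrelation g₁ g₂ t = 1 := by
  intro h
  obtain ⟨F, hF⟩ := exists_zeroAtInfty_windowCorrelation g₁ g₂
  -- Positive dimension makes the space noncompact, so its cocompact filter is nontrivial and limits
  -- along it are unique.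
  have : Nonempty (Fin d) := ⟨⟨0, hd⟩⟩
  have h₁ := F.zero_at_infty'
  have : (F : Eu d → ℂ) = fun _ => 1 := funext fun t => (hF t).trans (h t)
  change Filter.Tendsto (F : Eu d → ℂ) _ _ at h₁
  rw [this] at h₁
  exact one_ne_zero (tendsto_nhds_unique tendsto_const_nhds h₁)

theorem windowCorrelation_eq_one_of_averagedSymbol {d : ℕ} {g₁ g₂ : L2 d} {t : Eu d}
    (h : averagedSymbol g₁ g₂ (planeWaveLinf t) = planeWaveLinf t) :
    windowCorrelation g₁ g₂ t = 1 := by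
  have h₁ := averagedSymbol_planeWave g₁ g₂ t
  rw [h] at h₁
  obtain ⟨ξ, h₂, h₃⟩ := (h₁.and (coeFn_planeWaveLinf t)).exists
  have h₄ : planeWave t ξ ≠ 0 := by simp [planeWave]
  rw [h₃] at h₂
  exact mul_right_cancel₀ h₄ (h₂.symm.trans (one_mul _).symm)

theorem mainTheorem2 (d : ℕ) (hd : 0 < d) (g₁ g₂ : L2 d) :
    -- the operators and the product are well defined; boundedness; the characterization
    (∀ m : Linf d,
      IsBoundedLinearMap ℂ (fourierMultiplier m) ∧
      (∀ f : L2 d, IsStftMultiplierValue (oneTensor m) g₁ g₂ f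
        (stftMultiplier (oneTensor m) g₁ g₂ f)) ∧
      IsBoundedLinearMap ℂ (stftMultiplier (oneTensor m) g₁ g₂) ∧
      IsFourierMul m (windowCorrelation g₁ g₂) (fourierMul m (windowCorrelation g₁ g₂)) ∧
      ((∀ f : L2 d, stftMultiplier (oneTensor m) g₁ g₂ f = fourierMultiplier m f) ↔
        fourierMul m (windowCorrelation g₁ g₂) = fourierDist m)) ∧
    -- the condition for all `m` forces the correlation function to be identically one
    ((∀ m : Linf d, fourierMul m (windowCorrelation g₁ g₂) = fourierDist m) →
      ∀ t : Eu d, windowCorrelation g₁ g₂ t = 1) ∧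
    -- the correlation function is in `C₀`, hence never identically one
    (∃ F : C₀(Eu d, ℂ), ∀ t : Eu d, F t = windowCorrelation g₁ g₂ t) ∧
    (¬ ∀ t : Eu d, windowCorrelation g₁ g₂ t = 1) ∧
    -- hence the equality of the two operators fails for some `m`
    (∃ m : Linf d, ∃ f : L2 d,
      stftMultiplier (oneTensor m) g₁ g₂ f ≠ fourierMultiplier m f) := by
  refine ⟨fun m => ⟨isBoundedLinearMap_fourierMultiplier m, ?_, ?_, ?_, ?_⟩, fun h t => ?_,
    exists_zeroAtInfty_windowCorrelation g₁ g₂, not_forall_windowCorrelation_eq_one hd g₁ g₂, ?_⟩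
  · rw [stftMultiplier_oneTensor]
    exact isStftMultiplierValue_fourierMultiplier g₁ g₂ m
  · rw [stftMultiplier_oneTensor]
    exact isBoundedLinearMap_fourierMultiplier _
  · rw [fourierMul_windowCorrelation]
    exact isFourierMul_averagedSymbol g₁ g₂ m
  · rw [stftMultiplier_oneTensor, fourierMul_windowCorrelation, fourierDist_injective.eq_iff,
      ← funext_iff, fourierMultiplier_injective.eq_iff]
  · refine windowCorrelation_eq_one_of_averagedSymbol (fourierDist_injective ?_)
    rw [← fourierMul_windowCorrelation, h]
  · by_contra! h
    refine not_forall_windowCorrelation_eq_one hd g₁ g₂ fun t =>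
      windowCorrelation_eq_one_of_averagedSymbol (fourierMultiplier_injective ?_)
    rw [← stftMultiplier_oneTensor]
    exact funext (h _)
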